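/- Let $H$ be a Hausdorff topological abelian group which is either infinite or trivial (a torsion-free group always is). Then there is a Hausdorff divisible topological abelian group $G$ containing $H$ as a topological subgroup (i.e. there is an injective homomorphism $H\to G$ that is a homeomorphism onto its image with the subspace topology) such that $w(G)=w(H)$, $\chi(G)=\chi(H)$ and $ib(G)=ib(H)$; moreover, if $H$ is torsion-free, then $G$ is also torsion-free. Here, for a topological space $X$, the weight $w(X)$ is the smallest cardinality of a base of the topology of $X$, and the character $\chi(X)$ is the smallest cardinal $\tau$ such that every point of $X$ has a neighborhood base of cardinality at most $\tau$. For an abelian topological group $G$, the boundedness index $ib(G)$ is the smallest cardinal $\tau$ such that for every neighborhood $U$ of $0$ there is a subset $F\subseteq G$ with $G=F+U$ and $|F|\le\tau$. A group $G$ is divisible (torsion-free) if for all $a\in G$ and all integers $n\ge 1$ the equation $nx=a$ has at least one (at most one) solution $x\in G$. -/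

import Mathlib

open Set Topology
open scoped Cardinal Pointwise

universe u

/-- The weight `w(X)`: the smallest cardinality of a base of the topology of `X`. -/
noncomputable def topWeight (X : Type u) [TopologicalSpace X] : Cardinal.{u} :=
  sInf {τ | ∃ B : Set (Set X), TopologicalSpace.IsTopologicalBasis B ∧ #B = τ}

/-- The character `χ(X)`: the smallest cardinal `τ` such that every point of `X` has a
neighborhood base of cardinality at most `τ`. -/
noncomputable def topCharacter (X : Type u) [TopologicalSpace X] : Cardinal.{u} :=
  sInf {τ | ∀ x : X, ∃ B : Set (Set X), (𝓝 x).HasBasis (fun s => s ∈ B) id ∧ #B ≤ τ}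

/-- The boundedness index `ib(G)`: the smallest cardinal `τ` such that for every neighborhood `U`
of the origin there is `F ⊆ G` with `G = F + U` and `|F| ≤ τ`. -/
noncomputable def boundednessIndex (G : Type u) [AddCommGroup G] [TopologicalSpace G] :
    Cardinal.{u} :=
  sInf {τ | ∀ U ∈ 𝓝 (0 : G), ∃ F : Set G, F + U = univ ∧ #F ≤ τ}

/-! The group `H` sits in the divisible group `DivisibleEnvelope H`, formal rational combinations of
elements of `H` modulo the integral relations of `H`. For a neighbourhood `U` of zero in `H`, choose
neighbourhoods `V n` with `V (n + 1) + V (n + 1) ⊆ V n` and `V 0 ⊆ U`, and a tree of nested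
partitions of `H` whose level-`m` cells have differences in `V (2 * m + 1)`. A combination is small
when its pushforward to every level `m` has ℓ¹ norm at most `2 ^ m / 2 ^ j`. This gives a first
countable group topology on the envelope. Telescoping along the tree shows that it makes `U` a
neighbourhood of zero in `H` (`linearCombination_id_mem_of_cells`). Few cells suffice to keep the
boundedness index down (`colorFilter_le_envelopeBasis_nhds`).

For nondiscrete `H`, the infimum of these topologies over a local base induces the topology of `H`
without raising character or boundedness index. The envelope is not shown to be Hausdorff, so `G` is
a maximal essential extension `E` of `H` inside it: divisible by maximality, and Hausdorff and
torsion-free (if `H` is) because nonzero elements have nonzero multiples in `H`. The weight follows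
from `w ≤ χ * ib`. -/

/-! ### Maximal essential extensions -/

/-- `E` is an essential extension of `H` inside the ambient group. -/
def IsEssentialOver {D : Type*} [AddCommGroup D] (H E : AddSubgroup D) : Prop :=
  H ≤ E ∧ ∀ x ∈ E, x ≠ 0 → ∃ n : ℤ, n • x ∈ H ∧ n • x ≠ 0

theorem exists_maximal_essential {D : Type*} [AddCommGroup D] (H : AddSubgroup D) :
    ∃ E, Maximal (IsEssentialOver H) E := by
  have hchains : ∀ c ⊆ {E | IsEssentialOver H E}, IsChain (· ≤ ·) c → ∀ E ∈ c,
      ∃ ub ∈ {E | IsEssentialOver H E}, ∀ z ∈ c, z ≤ ub := by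
    intro c hc hchain E hE
    refine ⟨sSup c, ⟨(hc hE).1.trans (le_sSup hE), ?_⟩, fun z hz => le_sSup hz⟩
    intro x hx h0
    obtain ⟨F, hF, hxF⟩ := (AddSubgroup.mem_sSup_of_directedOn ⟨E, hE⟩ hchain.directedOn).1 hx
    exact (hc hF).2 x hxF h0
  obtain ⟨E, -, hE⟩ := zorn_le_nonempty₀ {E | IsEssentialOver H E} hchains H
    ⟨le_rfl, fun x hx h0 => ⟨1, by simpa using hx, by simpa using h0⟩⟩
  exact ⟨E, hE⟩

/-- If a `p`-th part `x` of `e` lies outside `E`, maximality yields a nonzero `y = f + k • x` whose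
multiples meet `E` only in zero. Then `p • y = 0`, and `p ∤ k` since otherwise `y ∈ E`. Bézout for
`p` and `k` now divides `e` by `p` inside `E`. -/
theorem exists_prime_nsmul_eq_of_maximal_essential {D : Type*} [AddCommGroup D]
    [DivisibleBy D ℕ] {H E : AddSubgroup D} (hE : Maximal (IsEssentialOver H) E)
    {p : ℕ} (hp : p.Prime) {e : D} (he : e ∈ E) : ∃ x ∈ E, p • x = e := by
  obtain ⟨x, hx⟩ : ∃ x : D, p • x = e := ⟨DivisibleBy.div e p, DivisibleBy.div_cancel e hp.ne_zero⟩
  by_cases hxE : x ∈ E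
  · exact ⟨x, hxE, hx⟩
  have hnot : ¬ IsEssentialOver H (E ⊔ AddSubgroup.zmultiples x) := fun h =>
    hxE (hE.2 h le_sup_left (AddSubgroup.mem_sup_right (AddSubgroup.mem_zmultiples x)))
  have hnot' : ∃ y ∈ E ⊔ AddSubgroup.zmultiples x, y ≠ 0 ∧ ∀ n : ℤ, n • y ∈ H → n • y = 0 := by
    by_contra! h
    exact hnot ⟨hE.1.1.trans le_sup_left, h⟩
  obtain ⟨y, hy, hy0, hyH⟩ := hnot'
  have hyE : ∀ n : ℤ, n • y ∈ E → n • y = 0 := by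
    intro n hn
    by_contra h0
    obtain ⟨m, hm, hm0⟩ := hE.1.2 _ hn h0
    rw [smul_smul] at hm hm0
    exact hm0 (hyH _ hm)
  obtain ⟨f, hf, z, hz, rfl⟩ := AddSubgroup.mem_sup.1 hy
  obtain ⟨k, rfl⟩ := AddSubgroup.mem_zmultiples_iff.1 hz
  have hx' : (p : ℤ) • x = e := by rw [natCast_zsmul, hx]
  have hpy : (p : ℤ) • f + k • e = 0 := by
    have h1 : (p : ℤ) • (f + k • x) = (p : ℤ) • f + k • e := by
      rw [smul_add, smul_comm, hx']
    rw [← h1]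
    exact hyE _ (by rw [h1]; exact E.add_mem (E.zsmul_mem hf _) (E.zsmul_mem he _))
  by_cases hpk : (p : ℤ) ∣ k
  · obtain ⟨l, rfl⟩ := hpk
    have : (1 : ℤ) • (f + ((p : ℤ) * l) • x) = 0 := hyE 1 (by
      rw [one_smul, mul_comm, mul_smul, hx']
      exact E.add_mem hf (E.zsmul_mem he _))
    rw [one_smul] at this
    exact absurd this hy0
  · have hcop : IsCoprime (p : ℤ) k :=
      (Nat.prime_iff_prime_int.1 hp).coprime_iff_not_dvd.2 hpk
    obtain ⟨u, v, huv⟩ := hcop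
    refine ⟨u • e - v • f, E.sub_mem (E.zsmul_mem he _) (E.zsmul_mem hf _), ?_⟩
    have h2 : k • e = -((p : ℤ) • f) := (neg_eq_of_add_eq_zero_right hpy).symm
    calc p • (u • e - v • f) = (u * p) • e + v • (-((p : ℤ) • f)) := by
          rw [← natCast_zsmul]; module
      _ = (u * p + v * k) • e := by rw [← h2]; module
      _ = e := by rw [huv, one_smul]

theorem exists_nsmul_eq_of_maximal_essential {D : Type*} [AddCommGroup D]
    [DivisibleBy D ℕ] {H E : AddSubgroup D} (hE : Maximal (IsEssentialOver H) E)
    (n : ℕ) (hn : n ≠ 0) : ∀ e ∈ E, ∃ x ∈ E, n • x = e := by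
  induction n using Nat.recOnMul with
  | zero => exact absurd rfl hn
  | one => exact fun e he => ⟨e, he, one_nsmul e⟩
  | prime p hp => exact fun e he => exists_prime_nsmul_eq_of_maximal_essential hE hp he
  | mul a b iha ihb =>
    intro e he
    obtain ⟨x, hx, rfl⟩ := iha (left_ne_zero_of_mul hn) e he
    obtain ⟨y, hy, rfl⟩ := ihb (right_ne_zero_of_mul hn) x hx
    exact ⟨y, hy, mul_smul a b y⟩

theorem nonempty_divisibleBy_of_maximal_essential {D : Type*} [AddCommGroup D]
    [DivisibleBy D ℕ] {H E : AddSubgroup D} (hE : Maximal (IsEssentialOver H) E) :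
    Nonempty (DivisibleBy E ℕ) := by
  refine ⟨divisibleByOfSMulRightSurj E ℕ fun {n} hn => ?_⟩
  rintro ⟨e, he⟩
  obtain ⟨x, hx, rfl⟩ := exists_nsmul_eq_of_maximal_essential hE n hn e he
  exact ⟨⟨x, hx⟩, rfl⟩

theorem isAddTorsionFree_of_essential {D H : Type*} [AddCommGroup D] [AddCommGroup H]
    {ι : H →+ D} (hι : Function.Injective ι) {E : AddSubgroup D}
    (hE : IsEssentialOver ι.range E) [IsAddTorsionFree H] : IsAddTorsionFree E := by
  refine ⟨fun n hn x y hxy => ?_⟩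
  by_contra hne
  have hsub : (x - y : D) ≠ 0 := fun h => hne (Subtype.ext (sub_eq_zero.1 h))
  obtain ⟨m, ⟨h, hh⟩, hm0⟩ := hE.2 _ (E.sub_mem x.2 y.2) hsub
  have hn0 : n • (x - y : D) = 0 := by
    have : n • (x : D) = n • (y : D) := congrArg Subtype.val hxy
    rw [smul_sub, this, sub_self]
  have h1 : n • h = 0 := hι (by
    rw [map_nsmul, hh, map_zero, smul_comm, hn0, smul_zero])
  have h0 : h = 0 := nsmul_right_injective hn (by simpa using h1)
  exact hm0 (by rw [← hh, h0, map_zero])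

/-! ### Weight, character and boundedness index -/

theorem boundednessIndex_spec (G : Type u) [AddCommGroup G] [TopologicalSpace G] :
    ∀ U ∈ 𝓝 (0 : G), ∃ F : Set G, F + U = univ ∧ #F ≤ boundednessIndex G := by
  refine csInf_mem (s := {τ | ∀ U ∈ 𝓝 (0 : G), ∃ F : Set G, F + U = univ ∧ #F ≤ τ}) ⟨#G, ?_⟩
  refine fun U hU => ⟨univ, ?_, Cardinal.mk_set_le _⟩
  exact eq_univ_of_forall fun x => ⟨x, mem_univ x, 0, mem_of_mem_nhds hU, add_zero x⟩

theorem boundednessIndex_le {G : Type u} [AddCommGroup G] [TopologicalSpace G] {τ : Cardinal.{u}}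
    (h : ∀ U ∈ 𝓝 (0 : G), ∃ F : Set G, F + U = univ ∧ #F ≤ τ) : boundednessIndex G ≤ τ :=
  csInf_le' h

theorem topCharacter_spec (X : Type u) [TopologicalSpace X] (x : X) :
    ∃ B : Set (Set X), (𝓝 x).HasBasis (fun s => s ∈ B) id ∧ #B ≤ topCharacter X := by
  refine csInf_mem (s := {τ | ∀ x : X, ∃ B : Set (Set X),
    (𝓝 x).HasBasis (fun s => s ∈ B) id ∧ #B ≤ τ}) ⟨#(Set X), ?_⟩ x
  exact fun x => ⟨{s | s ∈ 𝓝 x}, (𝓝 x).basis_sets, Cardinal.mk_set_le _⟩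

theorem topCharacter_le {X : Type u} [TopologicalSpace X] {τ : Cardinal.{u}}
    (h : ∀ x : X, ∃ B : Set (Set X), (𝓝 x).HasBasis (fun s => s ∈ B) id ∧ #B ≤ τ) :
    topCharacter X ≤ τ :=
  csInf_le' h

theorem topWeight_spec (X : Type u) [TopologicalSpace X] :
    ∃ B : Set (Set X), TopologicalSpace.IsTopologicalBasis B ∧ #B = topWeight X :=
  csInf_mem (s := {τ | ∃ B : Set (Set X), TopologicalSpace.IsTopologicalBasis B ∧ #B = τ})
    ⟨_, _, TopologicalSpace.isTopologicalBasis_opens, rfl⟩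

theorem topWeight_le {X : Type u} [TopologicalSpace X] {B : Set (Set X)}
    (h : TopologicalSpace.IsTopologicalBasis B) : topWeight X ≤ #B :=
  csInf_le' ⟨B, h, rfl⟩

theorem topCharacter_le_of_isInducing {X Y : Type u} [TopologicalSpace X] [TopologicalSpace Y]
    {f : X → Y} (hf : IsInducing f) : topCharacter X ≤ topCharacter Y := by
  refine topCharacter_le fun x => ?_
  obtain ⟨B, hB, hcard⟩ := topCharacter_spec Y (f x)
  refine ⟨preimage f '' B, ?_, Cardinal.mk_image_le.trans hcard⟩
  rw [hf.nhds_eq_comap]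
  refine (hB.comap f).to_hasBasis (fun s hs => ⟨_, ⟨s, hs, rfl⟩, subset_rfl⟩) ?_
  rintro _ ⟨s, hs, rfl⟩
  exact ⟨s, hs, subset_rfl⟩

theorem topWeight_le_of_isInducing {X Y : Type u} [TopologicalSpace X] [TopologicalSpace Y]
    {f : X → Y} (hf : IsInducing f) : topWeight X ≤ topWeight Y := by
  obtain ⟨B, hB, hcard⟩ := topWeight_spec Y
  exact (topWeight_le (hB.isInducing hf)).trans (Cardinal.mk_image_le.trans hcard.le)

theorem topCharacter_le_topWeight (X : Type u) [TopologicalSpace X] :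
    topCharacter X ≤ topWeight X := by
  obtain ⟨B, hB, hcard⟩ := topWeight_spec X
  refine topCharacter_le fun x => ⟨{s | s ∈ B ∧ x ∈ s}, hB.nhds_hasBasis, ?_⟩
  exact (Cardinal.mk_le_mk_of_subset fun s hs => hs.1).trans hcard.le

theorem topCharacter_le_of_hasBasis {G : Type u} [AddCommGroup G] [TopologicalSpace G]
    [IsTopologicalAddGroup G] {ι : Type u} {s : ι → Set G}
    (hs : (𝓝 (0 : G)).HasBasis (fun _ => True) s) : topCharacter G ≤ #ι := by
  refine topCharacter_le fun x => ⟨range fun i => (x + ·) '' s i, ?_, Cardinal.mk_range_le⟩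
  rw [← add_zero x, ← map_add_left_nhds_zero, add_zero]
  refine (hs.map (x + ·)).to_hasBasis (fun i _ => ⟨_, ⟨i, rfl⟩, subset_rfl⟩) ?_
  rintro _ ⟨i, rfl⟩
  exact ⟨i, trivial, subset_rfl⟩

theorem exists_nhds_zero_sub_mem {G : Type*} [AddCommGroup G] [TopologicalSpace G]
    [IsTopologicalAddGroup G] {U : Set G} (hU : U ∈ 𝓝 (0 : G)) :
    ∃ V ∈ 𝓝 (0 : G), ∀ v ∈ V, ∀ w ∈ V, v - w ∈ U := by
  have h : Filter.Tendsto (fun p : G × G => p.1 - p.2) (𝓝 (0, 0)) (𝓝 0) := by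
    have := (continuous_sub (G := G)).tendsto (0, 0)
    simpa using this
  rw [nhds_prod_eq] at h
  obtain ⟨V, hV, hVU⟩ := Filter.mem_prod_same_iff.1 (h hU)
  exact ⟨V, hV, fun v hv w hw => hVU (show (v, w) ∈ V ×ˢ V from ⟨hv, hw⟩)⟩

theorem boundednessIndex_le_topWeight (G : Type u) [AddCommGroup G] [TopologicalSpace G]
    [IsTopologicalAddGroup G] : boundednessIndex G ≤ topWeight G := by
  obtain ⟨B, hB, hcard⟩ := topWeight_spec G
  classical
  refine boundednessIndex_le fun U hU =>
    ⟨range fun b : B => if h : (b : Set G).Nonempty then h.some else 0, ?_,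
      Cardinal.mk_range_le.trans hcard.le⟩
  refine eq_univ_of_forall fun x => ?_
  have hx : (fun y => x - y) ⁻¹' U ∈ 𝓝 x :=
    (continuous_const.sub continuous_id).continuousAt.preimage_mem_nhds (by simpa using hU)
  obtain ⟨b, hb, hxb, hbU⟩ := hB.mem_nhds_iff.1 hx
  have hne : b.Nonempty := ⟨x, hxb⟩
  refine ⟨hne.some, ⟨⟨b, hb⟩, dif_pos hne⟩, x - hne.some, hbU hne.some_mem, ?_⟩
  simp

theorem topWeight_le_mul (G : Type u) [AddCommGroup G] [TopologicalSpace G]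
    [IsTopologicalAddGroup G] : topWeight G ≤ topCharacter G * boundednessIndex G := by
  obtain ⟨B, hB, hcard⟩ := topCharacter_spec G 0
  have hF : ∀ U : B, ∃ F : Set G, F + interior (U : Set G) = univ ∧ #F ≤ boundednessIndex G :=
    fun U => boundednessIndex_spec G _ (interior_mem_nhds.2 (hB.mem_of_mem U.2))
  choose F hF hFcard using hF
  -- For each `U` in a local base, take the translates of its interior by a set `F U` with `F U +
  -- interior U` everything.
  have hbasis : TopologicalSpace.IsTopologicalBasis
      (range fun p : Σ U : B, F U => (p.2 : G) +ᵥ interior (p.1 : Set G)) := by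
    refine TopologicalSpace.isTopologicalBasis_of_isOpen_of_nhds ?_ ?_
    · rintro _ ⟨p, rfl⟩
      exact isOpen_interior.vadd _
    · intro x O hx hO
      have h0 : (fun y => x + y) ⁻¹' O ∈ 𝓝 (0 : G) :=
        (continuous_const.add continuous_id).continuousAt.preimage_mem_nhds
          (by simpa using hO.mem_nhds hx)
      obtain ⟨V, hV, hVO⟩ := exists_nhds_zero_sub_mem h0
      obtain ⟨U, hU, hUV⟩ := hB.mem_iff.1 hV
      obtain ⟨f, hf, w, hw, hfw⟩ : x ∈ F ⟨U, hU⟩ + interior U := by rw [hF ⟨U, hU⟩]; trivial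
      refine ⟨_, ⟨⟨⟨U, hU⟩, ⟨f, hf⟩⟩, rfl⟩, ⟨w, hw, hfw⟩, ?_⟩
      rintro _ ⟨z, hz, rfl⟩
      have := hVO z (hUV (interior_subset hz)) w (hUV (interior_subset hw))
      have h2 : x + (z - w) = f + z := by rw [← hfw]; simp only; abel
      rwa [mem_preimage, h2] at this
  refine (topWeight_le hbasis).trans (Cardinal.mk_range_le.trans ?_)
  rw [Cardinal.mk_sigma]
  refine (Cardinal.sum_le_sum _ _ hFcard).trans ?_
  rw [Cardinal.sum_const']
  exact mul_le_mul_left hcard _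

/-- Pigeonhole: choose `n + 1` distinct points and `V` such that `V - V` misses their nonzero
differences. No translate of `V` contains two of them, so `n` translates cannot cover. -/
theorem aleph0_le_boundednessIndex (G : Type u) [AddCommGroup G] [TopologicalSpace G]
    [IsTopologicalAddGroup G] [T2Space G] [Infinite G] : ℵ₀ ≤ boundednessIndex G := by
  by_contra! hlt
  obtain ⟨n, hn⟩ := Cardinal.lt_aleph0.1 hlt
  let x : ℕ ↪ G := Infinite.natEmbedding G
  let S : Set G := (fun p : Fin (n + 1) × Fin (n + 1) => x p.1 - x p.2) '' {p | p.1 ≠ p.2}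
  have hS : Sᶜ ∈ 𝓝 (0 : G) := by
    refine (Set.toFinite S).isClosed.isOpen_compl.mem_nhds ?_
    rintro ⟨⟨i, j⟩, hij, h⟩
    exact hij (Fin.ext (x.injective (sub_eq_zero.1 h)))
  obtain ⟨V, hV, hVS⟩ := exists_nhds_zero_sub_mem hS
  obtain ⟨F, hF, hcard⟩ := boundednessIndex_spec G V hV
  have hrep : ∀ i : Fin (n + 1), ∃ f : F, x i - f ∈ V := by
    intro i
    obtain ⟨f, hf, v, hv, hfv⟩ : x i ∈ F + V := by rw [hF]; trivial
    exact ⟨⟨f, hf⟩, by simpa [← hfv] using hv⟩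
  choose f hf using hrep
  have hfin : Finite F := Cardinal.lt_aleph0_iff_finite.1 (hcard.trans_lt hlt)
  have hinj : Function.Injective f := by
    intro i j hij
    by_contra hne
    refine hVS _ (hf i) _ (hf j) ⟨(i, j), hne, ?_⟩
    simp [hij]
  have h1 := Nat.card_le_card_of_injective f hinj
  have h2 : Nat.card F ≤ n := by
    rw [hn, ← Nat.cast_card] at hcard
    exact_mod_cast hcard
  rw [Nat.card_fin] at h1
  omega

theorem aleph0_le_topCharacter (G : Type u) [AddCommGroup G] [TopologicalSpace G]
    [IsTopologicalAddGroup G] [T2Space G] (h : ¬ DiscreteTopology G) : ℵ₀ ≤ topCharacter G := by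
  by_contra! hlt
  obtain ⟨B, hB, hcard⟩ := topCharacter_spec G 0
  have hfin : B.Finite := Cardinal.lt_aleph0_iff_set_finite.1 (hcard.trans_lt hlt)
  have hmem : ⋂₀ B ∈ 𝓝 (0 : G) := (Filter.sInter_mem hfin).2 fun s hs => hB.mem_of_mem hs
  have h0 : ⋂₀ B ⊆ {0} := by
    intro x hx
    by_contra hne
    obtain ⟨s, hs, hsx⟩ := hB.mem_iff.1 (isOpen_compl_singleton.mem_nhds (Ne.symm hne) :
      ({x}ᶜ : Set G) ∈ 𝓝 0)
    exact hsx (hx s hs) rfl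
  exact h (discreteTopology_of_isOpen_singleton_zero
    (isOpen_singleton_iff_nhds_eq_pure 0 |>.2 (le_antisymm
      (Filter.le_pure_iff.2 (Filter.mem_of_superset hmem h0)) (pure_le_nhds 0))))

/-! ### Boundedness index through colourings -/

/-- The sets `U` such that `G` can be coloured by `C` with any two points of the same colour
differing by an element of `U`. -/
def colorFilter (G C : Type u) [AddCommGroup G] [Infinite C] : Filter G where
  sets := {U | ∃ φ : G → C, ∀ x y, φ x = φ y → x - y ∈ U}
  univ_sets := ⟨fun _ => Classical.arbitrary C, fun _ _ _ => trivial⟩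
  sets_of_superset := fun ⟨φ, hφ⟩ hUV => ⟨φ, fun x y h => hUV (hφ x y h)⟩
  inter_sets := by
    rintro U V ⟨φ, hφ⟩ ⟨ψ, hψ⟩
    obtain ⟨e⟩ : Nonempty (C × C ≃ C) := Cardinal.eq.1 (by simp)
    refine ⟨fun x => e (φ x, ψ x), fun x y h => ?_⟩
    have := e.injective h
    exact ⟨hφ x y (congrArg Prod.fst this), hψ x y (congrArg Prod.snd this)⟩

theorem mem_colorFilter_of_mk_le {G C D : Type u} [AddCommGroup G] [Infinite C] {U : Set G}
    (hD : #D ≤ #C) (φ : G → D) (hφ : ∀ x y, φ x = φ y → x - y ∈ U) : U ∈ colorFilter G C := by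
  obtain ⟨e⟩ := Cardinal.le_def D C |>.1 hD
  exact ⟨fun x => e (φ x), fun x y h => hφ x y (e.injective h)⟩

/-- Turns the bound into a comparison of filters, which passes to infima of topologies and, since
colourings restrict, to subgroups. A covering set `F` need not lie in the subgroup. -/
theorem boundednessIndex_le_iff {G C : Type u} [AddCommGroup G] [TopologicalSpace G]
    [IsTopologicalAddGroup G] [Infinite C] :
    boundednessIndex G ≤ #C ↔ colorFilter G C ≤ 𝓝 0 := by
  refine ⟨fun h U hU => ?_, fun h => boundednessIndex_le fun U hU => ?_⟩
  · obtain ⟨V, hV, hVU⟩ := exists_nhds_zero_sub_mem hU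
    obtain ⟨F, hF, hcard⟩ := boundednessIndex_spec G V hV
    have hrep : ∀ x : G, ∃ f : F, x - f ∈ V := by
      intro x
      obtain ⟨f, hf, v, hv, rfl⟩ : x ∈ F + V := by rw [hF]; trivial
      exact ⟨⟨f, hf⟩, by simpa using hv⟩
    choose f hf using hrep
    refine mem_colorFilter_of_mk_le (hcard.trans h) f fun x y hxy => ?_
    have := hVU _ (hf x) _ (hf y)
    rwa [hxy, sub_sub_sub_cancel_right] at this
  · obtain ⟨φ, hφ⟩ := h hU
    refine ⟨range (Function.invFun φ), eq_univ_of_forall fun x => ?_, Cardinal.mk_range_le⟩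
    refine ⟨_, ⟨φ x, rfl⟩, x - Function.invFun φ (φ x), hφ _ _ ?_, by simp⟩
    exact (Function.invFun_eq ⟨x, rfl⟩).symm

theorem colorFilter_le_nhds_of_isInducing {H G C : Type u} [AddCommGroup H] [TopologicalSpace H]
    [AddCommGroup G] [TopologicalSpace G] [Infinite C] {ι : H →+ G} (hι : IsInducing ι)
    (h : colorFilter G C ≤ 𝓝 0) : colorFilter H C ≤ 𝓝 0 := by
  rw [hι.nhds_eq_comap, map_zero]
  rintro U ⟨V, hV, hVU⟩
  obtain ⟨φ, hφ⟩ := h hV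
  refine ⟨fun x => φ (ι x), fun x y hxy => hVU ?_⟩
  simpa using hφ _ _ hxy

theorem boundednessIndex_le_of_isInducing {H G : Type u} [AddCommGroup H] [TopologicalSpace H]
    [IsTopologicalAddGroup H] [AddCommGroup G] [TopologicalSpace G] [IsTopologicalAddGroup G]
    {ι : H →+ G} (hι : IsInducing ι) (hG : ℵ₀ ≤ boundednessIndex G) :
    boundednessIndex H ≤ boundednessIndex G := by
  have : Infinite (boundednessIndex G).out := by rwa [Cardinal.infinite_iff, Cardinal.mk_out]
  rw [← Cardinal.mk_out (boundednessIndex G), boundednessIndex_le_iff]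
  exact colorFilter_le_nhds_of_isInducing hι (boundednessIndex_le_iff.1 (Cardinal.mk_out _).ge)

/-! ### The ℓ¹ norm of finitely supported functions -/

section FinsuppNorm

variable {X Y R : Type*} [Ring R] [LinearOrder R]

/-- The sum of the absolute values of the coefficients. -/
def Finsupp.absSum (a : X →₀ R) : R := a.sum fun _ r => |r|

theorem Finsupp.absSum_zero : (0 : X →₀ R).absSum = 0 := Finsupp.sum_zero_index

variable [IsStrictOrderedRing R]

theorem Finsupp.absSum_single (x : X) (r : R) : (Finsupp.single x r).absSum = |r| :=
  Finsupp.sum_single_index abs_zero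

theorem Finsupp.absSum_neg (a : X →₀ R) : (-a).absSum = a.absSum := by
  simp [Finsupp.absSum, Finsupp.sum_neg_index]

theorem Finsupp.absSum_add_le (a b : X →₀ R) : (a + b).absSum ≤ a.absSum + b.absSum := by
  classical
  unfold Finsupp.absSum
  rw [Finsupp.sum_of_support_subset (a + b) Finsupp.support_add _ (fun _ _ => abs_zero),
    Finsupp.sum_of_support_subset a Finset.subset_union_left _ (fun _ _ => abs_zero),
    Finsupp.sum_of_support_subset b Finset.subset_union_right _ (fun _ _ => abs_zero),
    ← Finset.sum_add_distrib]
  exact Finset.sum_le_sum fun i _ => abs_add_le _ _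

theorem Finsupp.absSum_sub_le (a b : X →₀ R) : (a - b).absSum ≤ a.absSum + b.absSum := by
  rw [sub_eq_add_neg, ← b.absSum_neg]
  exact Finsupp.absSum_add_le _ _

theorem Finsupp.absSum_single_add {x : X} {r : R} {a : X →₀ R} (hx : x ∉ a.support) :
    (Finsupp.single x r + a).absSum = |r| + a.absSum := by
  classical
  unfold Finsupp.absSum
  rw [Finsupp.sum_add_index_of_disjoint, Finsupp.sum_single_index abs_zero]
  exact Finset.disjoint_of_subset_left Finsupp.support_single_subset
    (Finset.disjoint_singleton_left.2 hx)

theorem Finsupp.absSum_mapDomain_le (f : X → Y) (a : X →₀ R) :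
    (a.mapDomain f).absSum ≤ a.absSum := by
  induction a using Finsupp.induction with
  | zero => simp [Finsupp.absSum_zero]
  | single_add x r a hx _ ih =>
    rw [Finsupp.mapDomain_add, Finsupp.mapDomain_single, Finsupp.absSum_single_add hx]
    exact (Finsupp.absSum_add_le _ _).trans (by rw [Finsupp.absSum_single]; gcongr)

theorem Finsupp.abs_le_absSum (a : X →₀ R) (x : X) : |a x| ≤ a.absSum := by
  by_cases hx : x ∈ a.support
  · exact Finset.single_le_sum (f := fun x => |a x|) (fun _ _ => abs_nonneg _) hx
  · rw [Finsupp.notMem_support_iff.1 hx, abs_zero]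
    exact Finset.sum_nonneg fun _ _ => abs_nonneg _

theorem Finsupp.absSum_intCast (a : X →₀ ℤ) :
    (a.mapRange (Int.cast : ℤ → ℚ) Int.cast_zero).absSum = a.absSum := by
  unfold Finsupp.absSum
  rw [Finsupp.sum_mapRange_index (fun _ => abs_zero)]
  simp [Finsupp.sum]

end FinsuppNorm

/-! ### Sums controlled by halving sequences -/

section Halving

variable {H : Type*} [AddCommGroup H] {V : ℕ → Set H}

theorem list_sum_mem_of_halving (h0 : ∀ n, (0 : H) ∈ V n)
    (hadd : ∀ n, ∀ x ∈ V (n + 1), ∀ y ∈ V (n + 1), x + y ∈ V n) (m n : ℕ) (l : List H)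
    (hlen : l.length ≤ 2 ^ m) (hl : ∀ x ∈ l, x ∈ V (n + m)) : l.sum ∈ V n := by
  induction m generalizing n l with
  | zero =>
    match l, hlen with
    | [], _ => exact h0 n
    | [x], _ => simpa using hl x
  | succ m ih =>
    rw [← List.take_append_drop (2 ^ m) l, List.sum_append]
    refine hadd n _ (ih (n + 1) _ (by simp) fun x hx => ?_)
      _ (ih (n + 1) _ (by rw [List.length_drop]; rw [pow_succ] at hlen; omega) fun x hx => ?_)
    · rw [add_assoc, add_comm 1 m]
      exact hl x (List.mem_of_mem_take hx)
    · rw [add_assoc, add_comm 1 m]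
      exact hl x (List.mem_of_mem_drop hx)

theorem exists_list_sum_eq_linearCombination {X : Type*} {S : Set H} (hneg : ∀ x ∈ S, -x ∈ S)
    (f : X → H) (b : X →₀ ℤ) (hf : ∀ x ∈ b.support, f x ∈ S) :
    ∃ l : List H, (l.length : ℤ) = b.absSum ∧ l.sum = Finsupp.linearCombination ℤ f b ∧
      ∀ x ∈ l, x ∈ S := by
  classical
  induction b using Finsupp.induction with
  | zero => exact ⟨[], by simp [Finsupp.absSum_zero], by simp, by simp⟩
  | single_add x z b hx hz ih =>
    have hsupp : (Finsupp.single x z + b).support = insert x b.support :=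
      (Finsupp.support_single_add hx hz).trans (Finset.cons_eq_insert _ _ _)
    rw [hsupp] at hf
    obtain ⟨l, hlen, hsum, hl⟩ := ih fun y hy => hf y (Finset.mem_insert_of_mem hy)
    have hxS := hf x (Finset.mem_insert_self _ _)
    rw [Finsupp.absSum_single_add hx, map_add, Finsupp.linearCombination_single]
    obtain ⟨n, rfl | rfl⟩ := z.eq_nat_or_neg
    · refine ⟨List.replicate n (f x) ++ l, by simp [hlen], by simp [hsum], ?_⟩
      intro y hy
      rcases List.mem_append.1 hy with h | h
      · rwa [List.eq_of_mem_replicate h]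
      · exact hl y h
    · refine ⟨List.replicate n (-f x) ++ l, by simp [hlen], by simp [hsum], ?_⟩
      intro y hy
      rcases List.mem_append.1 hy with h | h
      · rw [List.eq_of_mem_replicate h]
        exact hneg _ hxS
      · exact hl y h

theorem linearCombination_mem_of_halving {X : Type*} (h0 : ∀ n, (0 : H) ∈ V n)
    (hneg : ∀ n, ∀ x ∈ V n, -x ∈ V n)
    (hadd : ∀ n, ∀ x ∈ V (n + 1), ∀ y ∈ V (n + 1), x + y ∈ V n) (m n : ℕ) (f : X → H)
    (b : X →₀ ℤ) (hb : b.absSum ≤ 2 ^ m) (hf : ∀ x ∈ b.support, f x ∈ V (n + m)) :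
    Finsupp.linearCombination ℤ f b ∈ V n := by
  obtain ⟨l, hlen, hsum, hl⟩ := exists_list_sum_eq_linearCombination (hneg (n + m)) f b hf
  rw [← hsum]
  refine list_sum_mem_of_halving h0 hadd m n l ?_ hl
  rw [← hlen] at hb
  exact_mod_cast hb

theorem sum_range_add_mem_of_halving
    (hadd : ∀ n, ∀ x ∈ V (n + 1), ∀ y ∈ V (n + 1), x + y ∈ V n) (d : ℕ → H)
    (hd : ∀ m, d m ∈ V (m + 1)) (M k : ℕ) (x : H) (hx : x ∈ V (k + M)) :
    ∑ i ∈ Finset.range M, d (k + i) + x ∈ V k := by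
  induction M generalizing k with
  | zero => simpa using hx
  | succ M ih =>
    rw [Finset.sum_range_succ', add_zero, add_comm (∑ i ∈ Finset.range M, _), add_assoc]
    refine hadd k _ (hd k) _ ?_
    have := ih (k + 1) (by rwa [add_assoc, add_comm 1 M])
    simpa only [add_assoc, add_comm 1] using this

theorem halving_antitone (h0 : ∀ n, (0 : H) ∈ V n)
    (hadd : ∀ n, ∀ x ∈ V (n + 1), ∀ y ∈ V (n + 1), x + y ∈ V n) : Antitone V :=
  antitone_nat_of_succ_le fun n x hx => by simpa using hadd n x hx 0 (h0 _)

variable {Y : Type*} {c : ℕ → H → Y} {t : Y → Y}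

/-- An integral combination whose flow through every level of a tree of cells is small has a
small value, provided that the cells shrink quickly. -/
theorem linearCombination_id_mem_of_cells (h0 : ∀ n, (0 : H) ∈ V n)
    (hneg : ∀ n, ∀ x ∈ V n, -x ∈ V n)
    (hadd : ∀ n, ∀ x ∈ V (n + 1), ∀ y ∈ V (n + 1), x + y ∈ V n)
    (ht : ∀ m h, t (c (m + 1) h) = c m h)
    (hc : ∀ m h h', c m h = c m h' → h - h' ∈ V (2 * m + 1)) (b : H →₀ ℤ)
    (hb : ∀ m, (b.mapDomain (c m)).absSum * 2 ≤ 2 ^ m) :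
    Finsupp.linearCombination ℤ id b ∈ V 0 := by
  let r : ℕ → Y → H := fun m => Function.invFun (c m)
  have hr : ∀ m h, c m (r m (c m h)) = c m h := fun m h => Function.invFun_eq ⟨h, rfl⟩
  let E : ℕ → H := fun m => Finsupp.linearCombination ℤ (r m) (b.mapDomain (c m))
  -- At level 0 the integral norm is at most `1 / 2`, hence zero.
  have hE0 : E 0 = 0 := by
    have : b.mapDomain (c 0) = 0 := by
      ext y
      have h1 := Finsupp.abs_le_absSum (b.mapDomain (c 0)) y
      have h2 := hb 0
      rw [Finsupp.zero_apply, ← Int.abs_lt_one_iff]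
      omega
    simp only [E, this, map_zero]
  have hd : ∀ m, E (m + 1) - E m ∈ V (m + 1) := by
    intro m
    have h1 : b.mapDomain (c m) = (b.mapDomain (c (m + 1))).mapDomain t := by
      rw [← Finsupp.mapDomain_comp]
      congr 1
      exact funext fun h => (ht m h).symm
    have h2 : E (m + 1) - E m = Finsupp.linearCombination ℤ
        (fun y => r (m + 1) y - r m (t y)) (b.mapDomain (c (m + 1))) := by
      have h3 : E m = Finsupp.linearCombination ℤ (r m ∘ t) (b.mapDomain (c (m + 1))) := by
        simp only [E, h1, Finsupp.linearCombination_mapDomain _ t]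
      rw [h3]
      simp only [E]
      simp only [Finsupp.linearCombination_apply, Finsupp.sum, smul_sub,
        Finset.sum_sub_distrib, Function.comp]
    rw [h2]
    -- The flow through level `m + 1` is at most `2 ^ m` and each coefficient vector lies in `V (2 *
    -- m + 1)`; summing costs `m` halvings and leaves `V (m + 1)`.
    refine linearCombination_mem_of_halving h0 hneg hadd m (m + 1) _ _ ?_ fun y hy => ?_
    · have := hb (m + 1)
      rw [pow_succ] at this
      omega
    · classical
      obtain ⟨h, -, rfl⟩ := Finset.mem_image.1 (Finsupp.mapDomain_support hy)
      rw [show m + 1 + m = 2 * m + 1 by ring]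
      refine hc m _ _ ?_
      rw [ht, hr, ← ht m (r (m + 1) _), hr, ht]
  -- Stop the telescoping at a level so deep that replacing every point by the representative of its
  -- cell costs only an element of `V M`.
  obtain ⟨M, hM⟩ : ∃ M : ℕ, b.absSum ≤ 2 ^ M := by
    refine ⟨b.absSum.toNat, b.absSum.self_le_toNat.trans ?_⟩
    exact_mod_cast Nat.lt_two_pow_self.le
  have htail : Finsupp.linearCombination ℤ id b - E M ∈ V (0 + M) := by
    have h2 : Finsupp.linearCombination ℤ id b - E M = Finsupp.linearCombination ℤ
        (fun h => h - r M (c M h)) b := by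
      simp only [E, Finsupp.linearCombination_mapDomain]
      simp only [Finsupp.linearCombination_apply, Finsupp.sum, smul_sub,
        Finset.sum_sub_distrib, Function.comp, id]
    rw [h2]
    refine linearCombination_mem_of_halving h0 hneg hadd M (0 + M) _ _ hM fun h _ => ?_
    exact halving_antitone h0 hadd (by omega) (hc M h _ (hr M h).symm)
  have := sum_range_add_mem_of_halving hadd _ hd M 0 _ htail
  simp only [zero_add] at this
  rwa [Finset.sum_range_sub E, hE0, sub_zero, add_sub_cancel] at this

end Halving

/-! ### Flow through a tree of cells -/

section Flow

variable {H Y : Type*} (c : ℕ → H → Y)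

/-- The rational combinations with small flow through every level of a tree of cells. -/
def flowBall (j : ℕ) : Set (H →₀ ℚ) :=
  {a | ∀ m, (a.mapDomain (c m)).absSum * 2 ^ j ≤ 2 ^ m}

theorem zero_mem_flowBall (j : ℕ) : (0 : H →₀ ℚ) ∈ flowBall c j := fun m => by
  simp [Finsupp.absSum_zero]

theorem neg_mem_flowBall {j : ℕ} {a : H →₀ ℚ} (ha : a ∈ flowBall c j) : -a ∈ flowBall c j :=
  fun m => by
    have : (-a).mapDomain (c m) = -a.mapDomain (c m) :=
      map_neg (Finsupp.mapDomain.addMonoidHom (c m)) a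
    rw [this, Finsupp.absSum_neg]
    exact ha m

theorem add_mem_flowBall {j : ℕ} {a b : H →₀ ℚ} (ha : a ∈ flowBall c (j + 1))
    (hb : b ∈ flowBall c (j + 1)) : a + b ∈ flowBall c j := fun m => by
  have h1 := ha m
  have h2 := hb m
  rw [pow_succ] at h1 h2
  have h3 := mul_le_mul_of_nonneg_right
    (Finsupp.absSum_add_le (a.mapDomain (c m)) (b.mapDomain (c m)))
    (pow_nonneg zero_le_two j : (0 : ℚ) ≤ 2 ^ j)
  rw [Finsupp.mapDomain_add]
  linarith

theorem flowBall_antitone : Antitone (flowBall c) :=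
  antitone_nat_of_succ_le fun j a ha => by
    simpa using add_mem_flowBall c ha (zero_mem_flowBall c _)

variable {c}

theorem mapDomain_cells_eq {t : Y → Y} (ht : ∀ m h, t (c (m + 1) h) = c m h) {a b : H →₀ ℚ} {m M : ℕ}
    (hmM : m ≤ M) (hab : a.mapDomain (c M) = b.mapDomain (c M)) :
    a.mapDomain (c m) = b.mapDomain (c m) := by
  induction M, hmM using Nat.le_induction with
  | base => exact hab
  | succ M _ ih =>
    refine ih ?_
    have h : c M = t ∘ c (M + 1) := funext fun x => (ht M x).symm
    rw [h, Finsupp.mapDomain_comp, Finsupp.mapDomain_comp, hab]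

end Flow

/-! ### The divisible envelope and its topology from a tree of cells -/

section Envelope

variable (H : Type u) [AddCommGroup H]

/-- The image in the rational vector space on `H` of the relations holding in `H`. -/
noncomputable def rationalRelations : AddSubgroup (H →₀ ℚ) :=
  (Finsupp.linearCombination ℤ (id : H → H)).toAddMonoidHom.ker.map
    (Finsupp.mapRange.addMonoidHom (Int.castAddHom ℚ))

/-- A divisible group containing `H`. -/
abbrev DivisibleEnvelope : Type u := (H →₀ ℚ) ⧸ rationalRelations H

variable {H}

theorem mem_rationalRelations {a : H →₀ ℚ} : a ∈ rationalRelations H ↔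
    ∃ b : H →₀ ℤ, Finsupp.linearCombination ℤ id b = 0 ∧
      b.mapRange (Int.cast : ℤ → ℚ) Int.cast_zero = a :=
  Iff.rfl

variable (H) in
/-- The canonical embedding of a group into its divisible envelope. -/
noncomputable def DivisibleEnvelope.of : H →+ DivisibleEnvelope H :=
  AddMonoidHom.mk' (fun h => QuotientAddGroup.mk (Finsupp.single h 1)) fun h k => by
    rw [← QuotientAddGroup.mk_add, QuotientAddGroup.eq, mem_rationalRelations]
    refine ⟨-Finsupp.single (h + k) 1 + (Finsupp.single h 1 + Finsupp.single k 1), by simp, ?_⟩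
    rw [Finsupp.mapRange_add Int.cast_add, Finsupp.mapRange_add Int.cast_add,
      Finsupp.mapRange_neg Int.cast_neg]
    simp only [Finsupp.mapRange_single, Int.cast_one]

noncomputable instance : DivisibleBy (H →₀ ℚ) ℕ :=
  divisibleByOfSMulRightSurj _ _ fun {n} hn a => ⟨(n : ℚ)⁻¹ • a, by
    have : (n : ℚ) ≠ 0 := by exact_mod_cast hn
    simp only [← Nat.cast_smul_eq_nsmul ℚ, smul_smul, mul_inv_cancel₀ this, one_smul]⟩

theorem mk_divisibleEnvelope_le [Infinite H] : #(DivisibleEnvelope H) ≤ #H :=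
  (Cardinal.mk_le_of_surjective QuotientAddGroup.mk_surjective).trans (by simp)

theorem DivisibleEnvelope.of_injective : Function.Injective (DivisibleEnvelope.of H) := by
  refine (injective_iff_map_eq_zero _).2 fun h hh => ?_
  obtain ⟨b, hb, hbh⟩ := mem_rationalRelations.1 ((QuotientAddGroup.eq_zero_iff _).1 hh)
  have : b = Finsupp.single h 1 := by
    ext x
    have := DFunLike.congr_fun hbh x
    classical
    simp only [Finsupp.mapRange_apply, Finsupp.single_apply] at this ⊢
    split_ifs at this ⊢ <;> exact_mod_cast this
  simpa [this] using hb

variable {Y : Type u} (c : ℕ → H → Y)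

/-- The basic neighbourhoods of zero in the divisible envelope given by a tree of cells. -/
@[reducible]
noncomputable def envelopeBasis : AddGroupFilterBasis (DivisibleEnvelope H) :=
  addGroupFilterBasisOfComm (range fun j => QuotientAddGroup.mk '' flowBall c j)
    (range_nonempty _)
    (by
      rintro _ _ ⟨i, rfl⟩ ⟨j, rfl⟩
      refine ⟨_, ⟨max i j, rfl⟩, subset_inter ?_ ?_⟩
      · exact image_mono (flowBall_antitone c (le_max_left i j))
      · exact image_mono (flowBall_antitone c (le_max_right i j)))
    (by
      rintro _ ⟨j, rfl⟩
      exact ⟨0, zero_mem_flowBall c j, rfl⟩)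
    (by
      rintro _ ⟨j, rfl⟩
      refine ⟨_, ⟨j + 1, rfl⟩, ?_⟩
      rintro _ ⟨_, ⟨a, ha, rfl⟩, _, ⟨b, hb, rfl⟩, rfl⟩
      exact ⟨a + b, add_mem_flowBall c ha hb, rfl⟩)
    (by
      rintro _ ⟨j, rfl⟩
      refine ⟨_, ⟨j, rfl⟩, ?_⟩
      rintro _ ⟨a, ha, rfl⟩
      exact ⟨-a, neg_mem_flowBall c ha, rfl⟩)

theorem envelopeBasis_nhds_zero :
    (@nhds _ (envelopeBasis c).topology (0 : DivisibleEnvelope H)).HasBasis (fun _ : ℕ => True)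
      fun j => QuotientAddGroup.mk '' flowBall c j :=
  (envelopeBasis c).nhds_zero_hasBasis.to_hasBasis
    (by rintro _ ⟨j, rfl⟩; exact ⟨j, trivial, subset_rfl⟩)
    (fun j _ => ⟨_, ⟨j, rfl⟩, subset_rfl⟩)

variable {c} {t : Y → Y}

/-- Colour a class by a level `M`, deep relative to the norm of a representative, and by the
pushforward to that level. For equal colours the difference has no flow up to level `M`, and beyond
it the norm bound suffices. -/
theorem colorFilter_le_envelopeBasis_nhds (ht : ∀ m h, t (c (m + 1) h) = c m h) {C : Type u}
    [Infinite C] (hY : #Y ≤ #C) :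
    colorFilter (DivisibleEnvelope H) C ≤ @nhds _ (envelopeBasis c).topology 0 := by
  rw [(envelopeBasis_nhds_zero c).ge_iff]
  intro j _
  have hM : ∀ a : H →₀ ℚ, ∃ M : ℕ, a.absSum * 2 ^ (j + 1) ≤ 2 ^ M := fun a => by
    obtain ⟨M, hM⟩ := pow_unbounded_of_one_lt (a.absSum * 2 ^ (j + 1)) (one_lt_two (α := ℚ))
    exact ⟨M, hM.le⟩
  choose M hM using hM
  refine mem_colorFilter_of_mk_le (D := ℕ × (Y →₀ ℚ)) ?_
    (fun x => (M x.out, x.out.mapDomain (c (M x.out)))) fun x y hxy => ?_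
  · have hC : ℵ₀ ≤ #C := Cardinal.aleph0_le_mk C
    rw [Cardinal.mk_prod]
    simp only [Cardinal.mk_nat, Cardinal.lift_aleph0, Cardinal.lift_uzero]
    refine Cardinal.mul_le_of_le hC hC ?_
    cases isEmpty_or_nonempty Y
    · exact (Cardinal.mk_le_aleph0).trans hC
    · simp [hY, hC]
  · simp only [Prod.mk.injEq] at hxy
    obtain ⟨h1, h2⟩ := hxy
    refine ⟨x.out - y.out, fun m => ?_, by simp⟩
    have hsub : (x.out - y.out).mapDomain (c m) = x.out.mapDomain (c m) - y.out.mapDomain (c m) :=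
      map_sub (Finsupp.mapDomain.addMonoidHom (c m)) _ _
    rw [hsub]
    rcases le_total m (M x.out) with hm | hm
    · rw [← h1] at h2
      rw [mapDomain_cells_eq ht hm h2, sub_self, Finsupp.absSum_zero, zero_mul]
      positivity
    · have hx := hM x.out
      have hy := hM y.out
      rw [← h1] at hy
      have hpow : (2 : ℚ) ^ M x.out ≤ 2 ^ m := pow_le_pow_right₀ one_le_two hm
      have h3 : (x.out.mapDomain (c m) - y.out.mapDomain (c m)).absSum ≤
          x.out.absSum + y.out.absSum :=
        (Finsupp.absSum_sub_le _ _).trans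
          (add_le_add (Finsupp.absSum_mapDomain_le _ _) (Finsupp.absSum_mapDomain_le _ _))
      have h4 := mul_le_mul_of_nonneg_right h3 (pow_nonneg zero_le_two j : (0 : ℚ) ≤ 2 ^ j)
      rw [pow_succ] at hx hy
      linarith

theorem of_mem_mk_image_flowBall {j : ℕ} {h : H} (hh : ∀ m ≤ j, c m h = c m 0) :
    DivisibleEnvelope.of H h ∈ QuotientAddGroup.mk '' flowBall c j := by
  -- Subtracting the generator at `0`, trivial in the quotient, cancels the flow through levels up
  -- to `j`; deeper levels carry at most `2`.
  refine ⟨Finsupp.single h 1 - Finsupp.single 0 1, fun m => ?_, ?_⟩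
  · have hsub : (Finsupp.single h (1 : ℚ) - Finsupp.single 0 1).mapDomain (c m) =
        Finsupp.single (c m h) 1 - Finsupp.single (c m 0) 1 := by
      refine (map_sub (Finsupp.mapDomain.addMonoidHom (M := ℚ) (c m)) _ _).trans ?_
      exact congrArg₂ (· - ·) Finsupp.mapDomain_single Finsupp.mapDomain_single
    rw [hsub]
    rcases le_or_gt m j with hm | hm
    · rw [hh m hm, sub_self, Finsupp.absSum_zero, zero_mul]
      positivity
    · have h1 : (Finsupp.single (c m h) (1 : ℚ) - Finsupp.single (c m 0) 1).absSum ≤ 2 := by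
        refine (Finsupp.absSum_sub_le _ _).trans ?_
        rw [Finsupp.absSum_single, Finsupp.absSum_single, abs_one]
        norm_num
      calc _ ≤ (2 : ℚ) * 2 ^ j := by gcongr
        _ = 2 ^ (j + 1) := by ring
        _ ≤ 2 ^ m := pow_le_pow_right₀ one_le_two hm
  · have h0 : DivisibleEnvelope.of H 0 = 0 := map_zero _
    rw [QuotientAddGroup.mk_sub]
    exact (congrArg (DivisibleEnvelope.of H h - ·) h0).trans (sub_zero _)

theorem mem_of_of_mem_mk_image_flowBall {V : ℕ → Set H} (h0 : ∀ n, (0 : H) ∈ V n)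
    (hneg : ∀ n, ∀ x ∈ V n, -x ∈ V n)
    (hadd : ∀ n, ∀ x ∈ V (n + 1), ∀ y ∈ V (n + 1), x + y ∈ V n)
    (ht : ∀ m h, t (c (m + 1) h) = c m h)
    (hc : ∀ m h h', c m h = c m h' → h - h' ∈ V (2 * m + 1)) {h : H}
    (hh : DivisibleEnvelope.of H h ∈ QuotientAddGroup.mk '' flowBall c 1) : h ∈ V 0 := by
  obtain ⟨a, ha, hah⟩ := hh
  obtain ⟨b, hb, hbh⟩ := mem_rationalRelations.1 (QuotientAddGroup.eq.1 hah)
  -- Relations are integral, so the small rational representative of `h` is itself integral and the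
  -- telescoping argument applies.
  let d : H →₀ ℤ := Finsupp.single h 1 - b
  have hd : d.mapRange (Int.cast : ℤ → ℚ) Int.cast_zero = a := by
    ext x
    have h1 := DFunLike.congr_fun hbh x
    simp only [d, Finsupp.mapRange_apply, Finsupp.sub_apply, Int.cast_sub, Finsupp.add_apply,
      Finsupp.neg_apply] at h1 ⊢
    rw [h1]
    classical
    simp only [Finsupp.single_apply]
    split_ifs <;> simp
  have hval : Finsupp.linearCombination ℤ id d = h := by simp [d, hb]
  rw [← hval]
  refine linearCombination_id_mem_of_cells h0 hneg hadd ht hc d fun m => ?_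
  have := ha m
  rw [← hd, Finsupp.mapDomain_mapRange _ _ _ _ (by exact Int.cast_add),
    Finsupp.absSum_intCast] at this
  rw [pow_one] at this
  exact_mod_cast this

end Envelope

/-! ### The envelope topology attached to one neighbourhood -/

theorem exists_halving_sequence {H : Type*} [AddCommGroup H] [TopologicalSpace H]
    [IsTopologicalAddGroup H] {U : Set H} (hU : U ∈ 𝓝 (0 : H)) :
    ∃ V : ℕ → Set H, (∀ n, V n ∈ 𝓝 0) ∧ (∀ n, ∀ x ∈ V n, -x ∈ V n) ∧
      (∀ n, ∀ x ∈ V (n + 1), ∀ y ∈ V (n + 1), x + y ∈ V n) ∧ V 0 ⊆ U := by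
  have step : ∀ S : {S : Set H // S ∈ 𝓝 0}, ∃ T : {S : Set H // S ∈ 𝓝 0},
      (∀ x ∈ T.1, -x ∈ T.1) ∧ ∀ x ∈ T.1, ∀ y ∈ T.1, x + y ∈ S.1 := by
    intro S
    obtain ⟨T, hT, hTS⟩ := exists_nhds_zero_sub_mem S.2
    refine ⟨⟨T ∩ -T, Filter.inter_mem hT (neg_mem_nhds_zero H hT)⟩,
      fun x hx => ⟨hx.2, by simpa using hx.1⟩, fun x hx y hy => ?_⟩
    simpa using hTS x hx.1 (-y) hy.2
  choose f hf1 hf2 using step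
  let W : ℕ → {S : Set H // S ∈ 𝓝 0} := fun n => Nat.rec (f ⟨U, hU⟩) (fun _ S => f S) n
  refine ⟨fun n => (W n).1, fun n => (W n).2, fun n => ?_, fun n => hf2 (W n), fun x hx => ?_⟩
  · cases n <;> exact hf1 _
  · simpa using hf2 ⟨U, hU⟩ x hx 0 (mem_of_mem_nhds (W 0).2)

/-- The path of length `m + 1`, deepest vertex first, given by a sequence of labels. -/
def labelPath {H S : Type*} (s : ℕ → H → S) : ℕ → H → List S
  | 0, h => [s 0 h]
  | m + 1, h => s (m + 1) h :: labelPath s m h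

theorem tail_labelPath {H S : Type*} (s : ℕ → H → S) (m : ℕ) (h : H) :
    (labelPath s (m + 1) h).tail = labelPath s m h := rfl

theorem label_eq_of_labelPath_eq {H S : Type*} {s : ℕ → H → S} {m : ℕ} {h h' : H}
    (hh : labelPath s m h = labelPath s m h') : s m h = s m h' := by
  cases m <;> exact List.head_eq_of_cons_eq hh

theorem labelPath_eq {H S : Type*} {s : ℕ → H → S} {m : ℕ} {h h' : H}
    (hh : ∀ i ≤ m, s i h = s i h') : labelPath s m h = labelPath s m h' := by
  induction m with
  | zero => exact congrArg (fun x => [x]) (hh 0 le_rfl)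
  | succ m ih =>
    exact congrArg₂ List.cons (hh _ le_rfl) (ih fun i hi => hh i (hi.trans m.le_succ))

/-- For each neighbourhood `U` of zero in `H`, the divisible envelope has a first countable group
topology, of no larger boundedness index, which is coarser than that of `H` on `H` but in which
`U` is a neighbourhood of zero. -/
theorem exists_envelope_topology {H C : Type u} [AddCommGroup H] [TopologicalSpace H]
    [IsTopologicalAddGroup H] [Infinite C] (hC : boundednessIndex H ≤ #C) {U : Set H}
    (hU : U ∈ 𝓝 (0 : H)) :
    ∃ T : TopologicalSpace (DivisibleEnvelope H), @IsTopologicalAddGroup _ T _ ∧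
      (∃ s : ℕ → Set (DivisibleEnvelope H), (@nhds _ T 0).HasBasis (fun _ => True) s) ∧
      colorFilter (DivisibleEnvelope H) C ≤ @nhds _ T 0 ∧
      𝓝 0 ≤ Filter.comap (DivisibleEnvelope.of H) (@nhds _ T 0) ∧
      U ∈ Filter.comap (DivisibleEnvelope.of H) (@nhds _ T 0) := by
  obtain ⟨V, hV, hneg, hadd, hVU⟩ := exists_halving_sequence hU
  have h0 : ∀ n, (0 : H) ∈ V n := fun n => mem_of_mem_nhds (hV n)
  have hcol := fun n => boundednessIndex_le_iff.1 hC (hV n)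
  choose φ hφ using hcol
  classical
  -- The extra label `none` makes the cell of `0` a neighbourhood of zero, which a colouring alone
  -- does not ensure. The index `2 * m + 2` leaves one halving for the difference of two points
  -- labelled `none`.
  let s : ℕ → H → Option C := fun m h => if h ∈ V (2 * m + 2) then none else some (φ (2 * m + 2) h)
  have hs : ∀ m h h', s m h = s m h' → h - h' ∈ V (2 * m + 1) := by
    intro m h h' hh
    have hanti := halving_antitone h0 hadd (by omega : 2 * m + 1 ≤ 2 * m + 2)
    by_cases h1 : h ∈ V (2 * m + 2) <;> by_cases h2 : h' ∈ V (2 * m + 2)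
    · rw [sub_eq_add_neg]
      exact hadd _ _ h1 _ (hneg _ _ h2)
    · simp [s, h1, h2] at hh
    · simp [s, h1, h2] at hh
    · simp only [s, h1, h2, if_false, Option.some.injEq] at hh
      exact hanti (hφ _ _ _ hh)
  have hY : #(List (Option C)) ≤ #C := by
    rw [Cardinal.mk_list_eq_mk, Cardinal.mk_option]
    exact (Cardinal.add_one_eq (Cardinal.aleph0_le_mk C)).le
  refine ⟨(envelopeBasis (labelPath s)).topology, inferInstance,
    ⟨_, envelopeBasis_nhds_zero (labelPath s)⟩,
    colorFilter_le_envelopeBasis_nhds (tail_labelPath s) hY, ?_, ?_⟩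
  · rw [((envelopeBasis_nhds_zero (labelPath s)).comap _).ge_iff]
    intro j _
    refine Filter.mem_of_superset (hV (2 * j + 2)) fun h hh => of_mem_mk_image_flowBall ?_
    intro m hm
    refine labelPath_eq fun i hi => ?_
    have hi' : h ∈ V (2 * i + 2) := halving_antitone h0 hadd (by omega) hh
    simp only [s, if_pos hi', if_pos (h0 _)]
  · refine ⟨_, (envelopeBasis_nhds_zero (labelPath s)).mem_of_mem (i := 1) trivial, ?_⟩
    intro h hh
    exact hVU (mem_of_of_mem_mk_image_flowBall h0 hneg hadd (tail_labelPath s)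
      (fun m h h' e => hs m h h' (label_eq_of_labelPath_eq e)) hh)

/-! ### Combining the topologies and passing to the essential extension -/

theorem exists_inducing_envelope_topology (H : Type u) [AddCommGroup H] [TopologicalSpace H]
    [IsTopologicalAddGroup H] [T2Space H] [Infinite H] :
    ∃ _ : TopologicalSpace (DivisibleEnvelope H), IsTopologicalAddGroup (DivisibleEnvelope H) ∧
      IsInducing (DivisibleEnvelope.of H) ∧
      topCharacter (DivisibleEnvelope H) ≤ topCharacter H ∧
      boundednessIndex (DivisibleEnvelope H) ≤ boundednessIndex H := by
  -- A discrete `H` has finite character, whereas the local base built below is always infinite.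
  by_cases hdisc : DiscreteTopology H
  · refine ⟨⊥, ?_⟩
    let _ : TopologicalSpace (DivisibleEnvelope H) := ⊥
    have : DiscreteTopology (DivisibleEnvelope H) := ⟨rfl⟩
    have hadd : IsTopologicalAddGroup (DivisibleEnvelope H) := inferInstance
    refine ⟨hadd, ?_, ?_, ?_⟩
    · exact (IsClosedEmbedding.of_continuous_injective_isClosedMap continuous_of_discreteTopology
        DivisibleEnvelope.of_injective fun _ _ => isClosed_discrete _).isInducing
    · have h1 : topCharacter (DivisibleEnvelope H) ≤ #PUnit.{u + 1} :=
        topCharacter_le_of_hasBasis (s := fun _ => {0}) (by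
          rw [nhds_discrete]
          exact ⟨fun t => by simp⟩)
      rw [Cardinal.mk_punit] at h1
      refine h1.trans (Cardinal.one_le_iff_ne_zero.2 fun h => ?_)
      obtain ⟨B, hB, hcard⟩ := topCharacter_spec H 0
      obtain ⟨b, hb, -⟩ := hB.mem_iff.1 Filter.univ_mem
      rw [h] at hcard
      exact Cardinal.mk_set_ne_zero_iff.2 ⟨b, hb⟩ (le_antisymm hcard zero_le)
    · have h1 : boundednessIndex (DivisibleEnvelope H) ≤ #(DivisibleEnvelope H) :=
        boundednessIndex_le fun U hU =>
          ⟨univ, eq_univ_of_forall fun x => ⟨x, trivial, 0, mem_of_mem_nhds hU, add_zero x⟩,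
            Cardinal.mk_set_le _⟩
      refine (h1.trans mk_divisibleEnvelope_le).trans ?_
      obtain ⟨F, hF, hcard⟩ := boundednessIndex_spec H {0} (by rw [nhds_discrete]; rfl)
      rw [singleton_zero, add_zero] at hF
      rwa [hF, Cardinal.mk_univ] at hcard
  · have hinf : Infinite (boundednessIndex H).out := by
      rw [Cardinal.infinite_iff, Cardinal.mk_out]
      exact aleph0_le_boundednessIndex H
    obtain ⟨B, hB, hcard⟩ := topCharacter_spec H 0
    have key := fun U : B => exists_envelope_topology (C := (boundednessIndex H).out)
      (Cardinal.mk_out _).ge (hB.mem_of_mem U.2)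
    choose T hT hbasis hcol hcont hmem using key
    choose s hs using hbasis
    let _ : TopologicalSpace (DivisibleEnvelope H) := ⨅ U, T U
    have hadd : IsTopologicalAddGroup (DivisibleEnvelope H) := topologicalAddGroup_iInf hT
    have hnhds : 𝓝 (0 : DivisibleEnvelope H) = ⨅ U, @nhds _ (T U) 0 := nhds_iInf
    refine ⟨inferInstance, hadd, ?_, ?_, ?_⟩
    · have h0 : 𝓝 (0 : H) = Filter.comap (DivisibleEnvelope.of H) (𝓝 0) := by
        rw [hnhds, Filter.comap_iInf]
        refine le_antisymm (le_iInf hcont) ?_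
        rw [hB.ge_iff]
        exact fun U hU => Filter.mem_iInf_of_mem ⟨U, hU⟩ (hmem ⟨U, hU⟩)
      exact (IsTopologicalAddGroup.isInducing_iff_nhds_zero).2 h0
    · have h1 : (𝓝 (0 : DivisibleEnvelope H)).HasBasis (fun _ : Finset (B × ℕ) => True)
          fun t => ⋂ p ∈ t, s p.1 p.2 := by
        have : 𝓝 (0 : DivisibleEnvelope H) = ⨅ p : B × ℕ, Filter.principal (s p.1 p.2) := by
          rw [hnhds, iInf_prod]
          refine iInf_congr fun U => ?_
          rw [(hs U).eq_iInf]
        rw [this]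
        refine (Filter.hasBasis_iInf_principal_finite _).to_hasBasis
          (fun t ht => ⟨ht.toFinset, trivial, by simp⟩)
          (fun t _ => ⟨t, t.finite_toSet, by simp⟩)
      refine (topCharacter_le_of_hasBasis h1).trans ?_
      have hχ := aleph0_le_topCharacter H hdisc
      have hne : Nonempty B := let ⟨b, hb, _⟩ := hB.mem_iff.1 Filter.univ_mem; ⟨⟨b, hb⟩⟩
      rw [Cardinal.mk_finset_of_infinite, Cardinal.mk_prod]
      simp only [Cardinal.mk_nat, Cardinal.lift_aleph0, Cardinal.lift_uzero]
      exact Cardinal.mul_le_of_le hχ hcard hχ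
    · rw [← Cardinal.mk_out (boundednessIndex H), boundednessIndex_le_iff, hnhds]
      exact le_iInf hcol

theorem corollary4 (H : Type u) [AddCommGroup H] [TopologicalSpace H] [IsTopologicalAddGroup H]
    [T2Space H] (hH : Infinite H ∨ Subsingleton H) :
    ∃ (G : Type u) (_ : AddCommGroup G) (_ : TopologicalSpace G) (ι : H →+ G),
      IsTopologicalAddGroup G ∧ T2Space G ∧ Nonempty (DivisibleBy G ℕ) ∧
      IsEmbedding ι ∧
      (IsAddTorsionFree H → IsAddTorsionFree G) ∧
      topWeight G = topWeight H ∧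
      topCharacter G = topCharacter H ∧
      boundednessIndex G = boundednessIndex H := by
  rcases hH with hinf | hsub
  swap
  · exact ⟨H, inferInstance, inferInstance, AddMonoidHom.id H, inferInstance, inferInstance,
      ⟨divisibleByOfSMulRightSurj H ℕ fun _ x => ⟨0, Subsingleton.elim _ _⟩⟩, IsEmbedding.id,
      id, rfl, rfl, rfl⟩
  obtain ⟨_, hadd, hind, hχ, hib⟩ := exists_inducing_envelope_topology H
  obtain ⟨E, hE⟩ := exists_maximal_essential (DivisibleEnvelope.of H).range
  have hinj := DivisibleEnvelope.of_injective (H := H)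
  let ι : H →+ E := (DivisibleEnvelope.of H).codRestrict E fun h => hE.1.1 ⟨h, rfl⟩
  have hι : IsInducing ι := (IsInducing.of_comp_iff IsInducing.subtypeVal).1 hind
  have hιinj : Function.Injective ι := fun x y h => hinj (congrArg Subtype.val h)
  have hEinf : Infinite E := Infinite.of_injective ι hιinj
  -- Some multiple `n • x` is a nonzero element of `H`; a neighbourhood of zero missing it pulls
  -- back along multiplication by `n` to one missing `x`.
  have hT2 : T2Space E := by
    refine IsTopologicalAddGroup.t2Space_of_zero_sep fun x hx => ?_
    obtain ⟨n, ⟨h, hh⟩, hn⟩ := hE.1.2 x x.2 fun h => hx (Subtype.ext h)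
    have hh' : ι h = n • x := Subtype.ext hh
    have hne : h ≠ 0 := by
      rintro rfl
      exact hn (by rw [← hh, map_zero])
    have hmem : ({h}ᶜ : Set H) ∈ 𝓝 0 := isOpen_compl_singleton.mem_nhds (Ne.symm hne)
    rw [hι.nhds_eq_comap, map_zero] at hmem
    obtain ⟨W, hW, hWh⟩ := hmem
    refine ⟨(fun y => n • y) ⁻¹' W, ?_, fun hx' => hWh (?_ : ι h ∈ W) rfl⟩
    · exact (continuous_zsmul n).continuousAt.preimage_mem_nhds (by simpa using hW)
    · rw [hh']
      exact hx'
  have hsubtype : IsInducing E.subtype := IsInducing.subtypeVal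
  have hχE : topCharacter E = topCharacter H :=
    le_antisymm ((topCharacter_le_of_isInducing hsubtype).trans hχ)
      (topCharacter_le_of_isInducing hι)
  have hibE : boundednessIndex E = boundednessIndex H := by
    refine le_antisymm ?_ (boundednessIndex_le_of_isInducing hι (aleph0_le_boundednessIndex E))
    have : Infinite (boundednessIndex H).out := by
      rw [Cardinal.infinite_iff, Cardinal.mk_out]
      exact aleph0_le_boundednessIndex H
    rw [← Cardinal.mk_out (boundednessIndex H)] at hib ⊢
    rw [boundednessIndex_le_iff] at hib ⊢
    exact colorFilter_le_nhds_of_isInducing hsubtype hib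
  refine ⟨E, inferInstance, inferInstance, ι, inferInstance, hT2,
    nonempty_divisibleBy_of_maximal_essential hE, ⟨hι, hιinj⟩, fun _ =>
      isAddTorsionFree_of_essential hinj hE.1, ?_, hχE, hibE⟩
  refine le_antisymm ((topWeight_le_mul E).trans ?_) (topWeight_le_of_isInducing hι)
  rw [hχE, hibE]
  exact Cardinal.mul_le_of_le
    ((aleph0_le_boundednessIndex H).trans (boundednessIndex_le_topWeight H))
    (topCharacter_le_topWeight H) (boundednessIndex_le_topWeight H)
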